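/- Let $Q=(Q,\le,\odot)$ be a commutative semicartesian quantale: a complete lattice with a commutative associative operation $\odot$ satisfying $a\odot\bigvee_i b_i=\bigvee_i(a\odot b_i)$ and $a\odot b\le a,\ a\odot b\le b$ for all $a,b,b_i\in Q$. (If $Q$ has a unit, the unit is the top element; a unit is not needed below.) Regard $Q$ as a poset category. A presheaf $F:Q^{op}\to \mathrm{Set}$ is a sheaf if for every family $(u_i)_{i\in I}$ in $Q$ and all $s_i\in F(u_i)$ with $s_i|_{u_i\odot u_j}=s_j|_{u_i\odot u_j}$ for all $i,j\in I$, there is a unique $s\in F(\bigvee_i u_i)$ with $s|_{u_i}=s_i$ for all $i$. Let $Sh(Q)$ be the full subcategory of sheaves in $PSh(Q)$, and let $\mathbf a$ be the left adjoint of the inclusion $Sh(Q)\hookrightarrow PSh(Q)$ (it exists). The representable presheaves $Q(-,a)$ are sheaves. For sheaves $F,G$ put $F\otimes G:=\mathbf a(F\otimes_{Day}G)$, where $F\otimes_{Day}G$ is the left Kan extension of $(u,v)\mapsto F(u)\times G(v)$ along $\odot:Q^{op}\times Q^{op}\to Q^{op}$. There are projections $F\otimes G\to F$ and $F\otimes G\to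 G$, induced by $(x,y)\mapsto x|_{u\odot v}$ and $(x,y)\mapsto y|_{u\odot v}$ for $(x,y)\in F(u)\times G(v)$. For a sheaf $F$ and subobjects $\phi_i:F_i\rightarrowtail F$ ($i=0,1$), let $F_0\otimes_F F_1\to F_0\otimes F_1$ be the equalizer of the two composites $F_0\otimes F_1\to F_i\xrightarrow{\phi_i}F$, and let $\phi_0*\phi_1\in Sub(F)$ be the least subobject of $F$ through which the resulting morphism $F_0\otimes_F F_1\to F$ factors. Then: 1. For every $a\in Q$, the poset $Sub(Q(-,a))$ of subobjects of $Q(-,a)$ in $Sh(Q)$, with the operation $*$, is a commutative semicartesian quantale; so is $[0,a]=\{q\in Q: q\le a\}$ with $\odot$; and the map $k_a:[0,a]\to Sub(Q(-,a))$, $q\mapsto[Q(-,q)\rightarrowtail Q(-,a)]$, is an isomorphism of quantales, i.e. an isomorphism of posets with $k_a(q\odot r)=k_a(q)*k_a(r)$. 2. If $\mathbf 1$ is the terminal sheaf, $(Sub(\mathbf 1),*)$ is a commutative semicartesian quantale and $Q\to Sub(\mathbf 1)$, $q\mapsto[Q(-,q)\rightarrowtail\mathbf 1]$, is an isomorphism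 of quantales. 3. If $Q$ is not a locale, i.e. $\odot\neq\wedge$, then $Sh(Q)$ is not an elementary topos (a cartesian closed category with pullbacks, a terminal object and a subobject classifier). In particular, this is so if the lattice $(Q,\le)$ has no underlying localic structure, i.e. if binary meets in $Q$ do not distribute over arbitrary joins. -/

import Mathlib

open CategoryTheory CategoryTheory.Limits Opposite
open scoped MonoidalCategory CategoryTheory.MonoidalCategory.ExternalProduct

universe u

/-- A multiplication on an ordered set is semicartesian when `a * b ≤ a` and `a * b ≤ b`. -/
class IsSemicartesian (Q : Type u) [Mul Q] [LE Q] : Prop where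
  mul_le_fst : ∀ a b : Q, a * b ≤ a
  mul_le_snd : ∀ a b : Q, a * b ≤ b

/-- The binary operation `m` makes the poset `P` a commutative semicartesian quantale. -/
structure IsCommSemicartesianQuantale {P : Type*} [PartialOrder P] (m : P → P → P) : Prop where
  exists_isLUB : ∀ S : Set P, ∃ x, IsLUB S x
  exists_isGLB : ∀ S : Set P, ∃ x, IsGLB S x
  assoc : ∀ x y z, m (m x y) z = m x (m y z)
  mul_isLUB : ∀ (x : P) (S : Set P) (s : P), IsLUB S s → IsLUB (m x '' S) (m x s)
  isLUB_mul : ∀ (x : P) (S : Set P) (s : P), IsLUB S s → IsLUB ((fun y => m y x) '' S) (m s x)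
  comm : ∀ x y, m x y = m y x
  le_fst : ∀ x y, m x y ≤ x
  le_snd : ∀ x y, m x y ≤ y

/-- `f` is an isomorphism of posets that carries the operation `m` to the operation `n`. -/
structure IsQuantaleIso {P R : Type*} [PartialOrder P] [PartialOrder R]
    (m : P → P → P) (n : R → R → R) (f : P → R) : Prop where
  bijective : Function.Bijective f
  le_iff_le : ∀ x y, f x ≤ f y ↔ x ≤ y
  map_mul : ∀ x y, f (m x y) = n (f x) (f y)

/-- An elementary topos: a cartesian closed category with pullbacks, a terminal object and a
subobject classifier. -/
def IsElementaryTopos (C : Type*) [Category C] : Prop :=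
  HasPullbacks C ∧ HasTerminal C ∧ HasSubobjectClassifier C ∧
    ∃ _ : CartesianMonoidalCategory C, Nonempty (MonoidalClosed C)

namespace QuantaleSheaf

section Presheaf

variable {Q : Type u} [Preorder Q]

/-- The restriction of a section along `w ≤ v`. -/
def res (F : Qᵒᵖ ⥤ Type u) {v w : Q} (h : w ≤ v) (s : F.obj (op v)) : F.obj (op w) :=
  F.map (homOfLE h).op s

lemma res_self (F : Qᵒᵖ ⥤ Type u) {v : Q} (h : v ≤ v) (s : F.obj (op v)) : res F h s = s := by
  simp [res]

lemma res_res (F : Qᵒᵖ ⥤ Type u) {v w x : Q} (h : w ≤ v) (h' : x ≤ w) (s : F.obj (op v)) :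
    res F h' (res F h s) = res F (h'.trans h) s := by
  have : (homOfLE (h'.trans h)).op = (homOfLE h).op ≫ (homOfLE h').op := rfl
  simp [res, this]

lemma res_naturality {F G : Qᵒᵖ ⥤ Type u} (f : F ⟶ G) {v w : Q} (h : w ≤ v)
    (s : F.obj (op v)) : f.app (op w) (res F h s) = res G h (f.app (op v) s) :=
  NatTrans.naturality_apply f (homOfLE h).op s

instance (a : Q) (c : Qᵒᵖ) : Subsingleton ((yoneda.obj a).obj c) :=
  inferInstanceAs (Subsingleton (unop c ⟶ a))

end Presheaf

section Sheaf

variable {Q : Type u} [CommSemigroup Q] [CompleteLattice Q] [IsSemicartesian Q]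

/-- A family of sections `s i ∈ F (U i)` is compatible when `s i` and `s j` agree on
`U i * U j`. -/
def Compatible (F : Qᵒᵖ ⥤ Type u) {I : Type u} (U : I → Q) (s : ∀ i, F.obj (op (U i))) : Prop :=
  ∀ i j, res F (IsSemicartesian.mul_le_fst (U i) (U j)) (s i) =
    res F (IsSemicartesian.mul_le_snd (U i) (U j)) (s j)

variable (Q) in
/-- A presheaf is a sheaf when every compatible family over a cover `⨆ i, U i` has a unique
gluing. -/
def IsSheaf : ObjectProperty (Qᵒᵖ ⥤ Type u) := fun F =>
  ∀ (I : Type u) (U : I → Q) (s : ∀ i, F.obj (op (U i))), Compatible F U s →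
    ∃! t : F.obj (op (⨆ i, U i)), ∀ i, res F (le_iSup U i) t = s i

variable (Q) in
/-- The category `Sh(Q)` of sheaves on `Q`, a full subcategory of the presheaves. -/
abbrev Sh : Type (u + 1) := (IsSheaf Q).FullSubcategory

lemma isSheaf_yoneda (a : Q) : IsSheaf Q (yoneda.obj a) := by
  intro I U s _
  have h : ⨆ i, U i ≤ a := iSup_le fun i => leOfHom (s i)
  exact ⟨homOfLE h, fun i => Subsingleton.elim _ _, fun _ _ => Subsingleton.elim _ _⟩

/-- The representable sheaf `Q(-, a)`. -/
abbrev reprSheaf (a : Q) : Sh Q := ⟨yoneda.obj a, isSheaf_yoneda a⟩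

/-- The morphism `Q(-, b) ⟶ Q(-, a)` for `b ≤ a`. -/
def reprMap {b a : Q} (h : b ≤ a) : reprSheaf b ⟶ reprSheaf a :=
  ObjectProperty.homMk (yoneda.map (homOfLE h))

instance (b : Q) {F : Sh Q} (f : reprSheaf b ⟶ F) : Mono f where
  right_cancellation g h _ := by
    ext v x
    exact Subsingleton.elim (α := (yoneda.obj b).obj v) _ _

end Sheaf

/-! ### Sheafification -/

section Sheafification

variable {Q : Type u} [CommSemigroup Q] [CompleteLattice Q] [IsSemicartesian Q]

/-- The coequalizer of `∐ Q(-, U i * U j) ⇉ ∐ Q(-, U i)`. -/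
def sieve {I : Type u} (U : I → Q) : Qᵒᵖ ⥤ Type u where
  obj c := Quot fun i j : {i : I // unop c ≤ U i} => unop c ≤ U i * U j
  map f := ↾(Quot.map (fun i => ⟨i.1, (leOfHom f.unop).trans i.2⟩)
    fun _ _ h => (leOfHom f.unop).trans h)
  map_id c := by
    ext x
    obtain ⟨i, rfl⟩ := Quot.exists_rep x
    rfl
  map_comp f g := by
    ext x
    obtain ⟨i, rfl⟩ := Quot.exists_rep x
    rfl

/-- The element of the sieve at `c` given by a member of the cover above `c`. -/
def sieveMk {I : Type u} (U : I → Q) {c : Q} (i : I) (h : c ≤ U i) : (sieve U).obj (op c) :=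
  Quot.mk _ ⟨i, h⟩

lemma res_sieveMk {I : Type u} (U : I → Q) {c d : Q} (i : I) (h : c ≤ U i) (hd : d ≤ c) :
    res (sieve U) hd (sieveMk U i h) = sieveMk U i (hd.trans h) := rfl

/-- The morphism from the sieve to the representable presheaf of the supremum. -/
def sieveMap {I : Type u} (U : I → Q) : sieve U ⟶ yoneda.obj (⨆ i, U i) where
  app c := ↾(Quot.lift (fun i => homOfLE (i.2.trans (le_iSup U i.1)))
    fun _ _ _ => Subsingleton.elim _ _)
  naturality _ _ _ := by
    ext x
    exact Subsingleton.elim (α := (yoneda.obj (⨆ i, U i)).obj _) _ _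

variable (F : Qᵒᵖ ⥤ Type u) {I : Type u} (U : I → Q)

/-- The morphism out of the sieve given by a compatible family. -/
def sieveDesc (s : ∀ i, F.obj (op (U i))) (hs : Compatible F U s) : sieve U ⟶ F where
  app c := ↾(Quot.lift (fun i => res F i.2 (s i.1)) fun i j h => by
    have := congrArg (res F h) (hs i.1 j.1)
    rwa [res_res, res_res] at this)
  naturality c d f := by
    ext x
    obtain ⟨i, rfl⟩ := Quot.exists_rep x
    exact (res_res F i.2 (leOfHom f.unop) (s i.1)).symm

/-- The family of sections given by a morphism out of the sieve. -/
def sieveFamily (f : sieve U ⟶ F) (i : I) : F.obj (op (U i)) :=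
  f.app (op (U i)) (sieveMk U i le_rfl)

lemma sieveFamily_compatible (f : sieve U ⟶ F) : Compatible F U (sieveFamily F U f) := by
  intro i j
  rw [sieveFamily, sieveFamily, ← res_naturality, ← res_naturality, res_sieveMk, res_sieveMk]
  exact congrArg (f.app (op (U i * U j))) (Quot.sound le_rfl)

lemma sieveFamily_desc (s : ∀ i, F.obj (op (U i))) (hs : Compatible F U s) :
    sieveFamily F U (sieveDesc F U s hs) = s := by
  funext i
  exact res_self F le_rfl (s i)

lemma sieve_hom_ext {f g : sieve U ⟶ F} (h : sieveFamily F U f = sieveFamily F U g) : f = g := by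
  ext c x
  obtain ⟨i, rfl⟩ := Quot.exists_rep x
  have := congrArg (res F i.2) (congrFun h i.1)
  rw [sieveFamily, sieveFamily, ← res_naturality, ← res_naturality] at this
  exact this

lemma sieveFamily_comp (g : yoneda.obj (⨆ i, U i) ⟶ F) (i : I) :
    sieveFamily F U (sieveMap U ≫ g) i = res F (le_iSup U i) (yonedaEquiv g) := by
  have := res_naturality g (le_iSup U i) (𝟙 (⨆ i, U i))
  rw [yonedaEquiv_apply, ← this]
  exact congrArg (g.app (op (U i)))
    (Subsingleton.elim (α := (yoneda.obj (⨆ i, U i)).obj (op (U i))) _ _)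

lemma bijective_sieveMap_iff :
    Function.Bijective (fun g : yoneda.obj (⨆ i, U i) ⟶ F => sieveMap U ≫ g) ↔
      ∀ s : ∀ i, F.obj (op (U i)), Compatible F U s →
        ∃! t : F.obj (op (⨆ i, U i)), ∀ i, res F (le_iSup U i) t = s i := by
  constructor
  · intro h s hs
    obtain ⟨g, hg⟩ := h.2 (sieveDesc F U s hs)
    refine ⟨yonedaEquiv g, fun i => ?_, fun t ht => ?_⟩
    · rw [← sieveFamily_comp]
      dsimp only at hg
      rw [hg, sieveFamily_desc]
    · obtain ⟨g', rfl⟩ := yonedaEquiv.surjective t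
      congr 1
      refine h.1 (Eq.trans (sieve_hom_ext F U ?_) hg.symm)
      rw [sieveFamily_desc]
      funext i
      rw [sieveFamily_comp, ht]
  · intro h
    constructor
    · intro g g' hg
      dsimp only at hg
      apply yonedaEquiv.injective
      refine (h _ (sieveFamily_compatible F U (sieveMap U ≫ g))).unique (fun i => ?_) fun i => ?_
      · rw [sieveFamily_comp]
      · rw [hg, sieveFamily_comp]
    · intro f
      obtain ⟨t, ht, -⟩ := h _ (sieveFamily_compatible F U f)
      refine ⟨yonedaEquiv.symm t, sieve_hom_ext F U ?_⟩
      funext i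
      rw [sieveFamily_comp, Equiv.apply_symm_apply, ht]

variable (Q) in
/-- A small family of morphisms whose local objects are the sheaves. Families indexed by subsets
of `Q × Bool` suffice, because a compatible family on a sheaf takes equal values at indices with
equal members of the cover. -/
abbrev coverings : MorphismProperty (Qᵒᵖ ⥤ Type u) :=
  MorphismProperty.ofHoms fun T : Set (Q × Bool) => sieveMap fun i : T => i.1.1

variable (Q) in
lemma isLocal_coverings : (coverings Q).isLocal = IsSheaf Q := by
  ext F
  constructor
  · intro hF
    have key (T : Set (Q × Bool)) := (bijective_sieveMap_iff F fun i : T => i.1.1).1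
      (hF _ (MorphismProperty.ofHoms.mk T))
    have inj {v : Q} {x y : F.obj (op v)}
        (h : res F (IsSemicartesian.mul_le_fst v v) x =
          res F (IsSemicartesian.mul_le_fst v v) y) : x = y := by
      let T : Set (Q × Bool) := {p | p.1 = v}
      have hT (i : T) : i.1.1 = v := i.2
      have hs (i : T) : i.1.1 ≤ v := (hT i).le
      obtain ⟨t, ht, -⟩ := key T (fun i => res F (hs i) (if i.1.2 then x else y)) (by
        rintro ⟨⟨w, b⟩, hw⟩ ⟨⟨w', b'⟩, hw'⟩
        obtain rfl : w = v := hw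
        obtain rfl : w' = w := hw'
        simp only [res_self]
        cases b <;> cases b' <;> simp [h])
      have h1 := ht ⟨(v, true), rfl⟩
      have h2 := ht ⟨(v, false), rfl⟩
      simp only [res_self] at h1 h2
      simpa using h1.symm.trans h2
    intro I U s hs
    have eqv (i j : I) (w : Q) (hi : w = U i) (hj : w = U j) :
        res F hi.le (s i) = res F hj.le (s j) := by
      apply inj
      rw [res_res, res_res]
      have := congrArg (res F (show w * w ≤ U i * U j by rw [← hi, ← hj])) (hs i j)
      rwa [res_res, res_res] at this
    let T : Set (Q × Bool) := {p | p.2 = true ∧ ∃ i, p.1 = U i}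
    choose f hf using fun i : T => i.2.2
    have hsup : ⨆ i : T, i.1.1 = ⨆ i, U i := by
      apply le_antisymm
      · exact iSup_le fun i => (hf i).le.trans (le_iSup U _)
      · exact iSup_le fun i => le_iSup (fun i : T => i.1.1) ⟨(U i, true), rfl, i, rfl⟩
    obtain ⟨t, ht, huniq⟩ := key T (fun i => res F (hf i).le (s (f i))) (by
      intro i j
      have := congrArg (res F (show i.1.1 * j.1.1 ≤ U (f i) * U (f j) by
        rw [← hf i, ← hf j])) (hs (f i) (f j))
      rw [res_res, res_res] at this ⊢
      exact this)
    refine ⟨res F hsup.ge t, fun i => ?_, fun t' ht' => ?_⟩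
    · have h1 := ht ⟨(U i, true), rfl, i, rfl⟩
      have h2 := eqv (f ⟨(U i, true), rfl, i, rfl⟩) i (U i) (hf ⟨(U i, true), rfl, i, rfl⟩) rfl
      rw [res_self F le_rfl] at h2
      rw [res_res]
      exact h1.trans h2
    · have h1 := huniq (res F hsup.le t') fun i => by
        rw [res_res, ← ht' (f i), res_res]
      rw [← h1, res_res, res_self]
  · rintro hF _ _ _ ⟨T⟩
    exact (bijective_sieveMap_iff F _).2 (hF T _)

variable (Q) in
lemma isRightAdjoint_ι : (IsSheaf Q).ι.IsRightAdjoint := by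
  rw [← isLocal_coverings Q]
  choose κ hκ hκ' using fun X : (Set (Q × Bool) × Bool) =>
    Functor.IsAccessible.exists_cardinal.{u} (F := coyoneda.obj (op
      (if X.2 then sieve (fun i : X.1 => i.1.1) else yoneda.obj (⨆ i : X.1, i.1.1))))
  let κ' : Cardinal.{u} := Order.succ (max Cardinal.aleph0 (⨆ X, κ X))
  have : Fact κ'.IsRegular := ⟨Cardinal.isRegular_succ (le_max_left _ _)⟩
  have hle (X) : κ X ≤ κ' :=
    (le_ciSup (Cardinal.bddAbove_of_small) X).trans ((le_max_right _ _).trans (Order.le_succ _))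
  refine MorphismProperty.isRightAdjoint_ι_isLocal (coverings Q) κ' ?_
  rintro _ _ _ ⟨T⟩
  have h₁ : (coyoneda.obj (op (sieve fun i : T => i.1.1))).IsCardinalAccessible (κ (T, true)) :=
    hκ' (T, true)
  have h₂ : (coyoneda.obj (op (yoneda.obj (⨆ i : T, i.1.1)))).IsCardinalAccessible
    (κ (T, false)) := hκ' (T, false)
  exact ⟨Functor.isCardinalAccessible_of_le _ (hle (T, true)),
    Functor.isCardinalAccessible_of_le _ (hle (T, false))⟩

noncomputable instance : Reflective (IsSheaf Q).ι where
  L := @Functor.leftAdjoint _ _ _ _ (IsSheaf Q).ι (isRightAdjoint_ι Q)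
  adj := @Adjunction.ofIsRightAdjoint _ _ _ _ (IsSheaf Q).ι (isRightAdjoint_ι Q)

variable (Q) in
/-- The sheafification functor, left adjoint to the inclusion of sheaves into presheaves. -/
noncomputable abbrev sheafification : (Qᵒᵖ ⥤ Type u) ⥤ Sh Q := reflector (IsSheaf Q).ι

instance : HasLimitsOfSize.{u, u} (Sh Q) := hasLimits_of_reflective (IsSheaf Q).ι

instance : HasFiniteLimits (Sh Q) := hasFiniteLimits_of_hasLimitsOfSize (Sh Q)

lemma exists_repr_hom (F : Sh Q) (a : Q) (x : F.obj.obj (op a)) :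
    ∃ f : reprSheaf a ⟶ F, yonedaEquiv f.hom = x :=
  ⟨ObjectProperty.homMk (yonedaEquiv.symm x), yonedaEquiv.apply_symm_apply x⟩

instance : WellPowered.{u} (Sh Q) := by
  refine wellPowered_of_isDetecting (𝒢 := ObjectProperty.ofObj (reprSheaf (Q := Q))) ?_
  intro F G f hf
  have (a : Q) : Function.Bijective (f.hom.app (op a)) := by
    have comp (g : reprSheaf a ⟶ F) : yonedaEquiv (g ≫ f).hom = f.hom.app (op a) (yonedaEquiv g.hom) :=
      yonedaEquiv_comp _ _
    constructor
    · intro x y hxy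
      obtain ⟨g, rfl⟩ := exists_repr_hom F a x
      obtain ⟨g', rfl⟩ := exists_repr_hom F a y
      obtain ⟨k, -, hk⟩ := hf _ (ObjectProperty.ofObj_apply _ a) (g ≫ f)
      have : g' ≫ f = g ≫ f := by
        ext1
        apply yonedaEquiv.injective
        rw [comp, comp, hxy]
      rw [hk g rfl, hk g' this]
    · intro y
      obtain ⟨g, rfl⟩ := exists_repr_hom G a y
      obtain ⟨k, hk, -⟩ := hf _ (ObjectProperty.ofObj_apply _ a) g
      exact ⟨yonedaEquiv k.hom, by rw [← comp, hk]⟩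
  have : IsIso ((IsSheaf Q).ι.map f) := by
    change IsIso f.hom
    rw [NatTrans.isIso_iff_isIso_app]
    exact fun a => (isIso_iff_bijective _).2 (this (unop a))
  exact isIso_of_fully_faithful (IsSheaf Q).ι f

end Sheafification

/-! ### The tensor product and the operation on subobjects -/

section Tensor

variable {Q : Type u} [CommSemigroup Q] [CompleteLattice Q] [IsQuantale Q] [IsSemicartesian Q]

variable (Q) in
/-- The multiplication of `Q` as a functor. -/
def mulFunctor : Qᵒᵖ × Qᵒᵖ ⥤ Qᵒᵖ where
  obj p := op (unop p.1 * unop p.2)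
  map f := (homOfLE (mul_le_mul' (leOfHom f.1.unop) (leOfHom f.2.unop))).op

/-- The Day convolution of two presheaves: the left Kan extension of the external product
`(u, v) ↦ F u × G v` along the multiplication of `Q`. -/
noncomputable def day (F G : Qᵒᵖ ⥤ Type u) : Qᵒᵖ ⥤ Type u :=
  (mulFunctor Q).leftKanExtension (F ⊠ G)

/-- The projection of the Day convolution to the first factor, given on `F u × G v` by
`(x, y) ↦ x` restricted to `u * v`. -/
noncomputable def dayFst (F G : Qᵒᵖ ⥤ Type u) : day F G ⟶ F :=
  Functor.descOfIsLeftKanExtension _ ((mulFunctor Q).leftKanExtensionUnit (F ⊠ G)) F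
    { app := fun p => ↾fun x : F.obj p.1 × G.obj p.2 =>
        res F (IsSemicartesian.mul_le_fst (unop p.1) (unop p.2)) x.1
      naturality := fun p q f => by
        ext x
        exact (res_res F _ _ _).trans (res_res F _ _ _).symm }

/-- The projection of the Day convolution to the second factor, given on `F u × G v` by
`(x, y) ↦ y` restricted to `u * v`. -/
noncomputable def daySnd (F G : Qᵒᵖ ⥤ Type u) : day F G ⟶ G :=
  Functor.descOfIsLeftKanExtension _ ((mulFunctor Q).leftKanExtensionUnit (F ⊠ G)) G
    { app := fun p => ↾fun x : F.obj p.1 × G.obj p.2 =>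
        res G (IsSemicartesian.mul_le_snd (unop p.1) (unop p.2)) x.2
      naturality := fun p q f => by
        ext x
        exact (res_res G _ _ _).trans (res_res G _ _ _).symm }

/-- The tensor product of sheaves: the sheafification of the Day convolution. -/
noncomputable def tensor (F G : Sh Q) : Sh Q := (sheafification Q).obj (day F.obj G.obj)

/-- The projection `F ⊗ G ⟶ F`. -/
noncomputable def tensorFst (F G : Sh Q) : tensor F G ⟶ F :=
  ((reflectorAdjunction (IsSheaf Q).ι).homEquiv _ _).symm (dayFst F.obj G.obj)

/-- The projection `F ⊗ G ⟶ G`. -/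
noncomputable def tensorSnd (F G : Sh Q) : tensor F G ⟶ G :=
  ((reflectorAdjunction (IsSheaf Q).ι).homEquiv _ _).symm (daySnd F.obj G.obj)

/-- The mono part of the extremal factorization of a morphism: the least subobject of the target
through which the morphism factors. -/
noncomputable def extremalImage {G F : Sh Q} (f : G ⟶ F) : Subobject F :=
  sInf {S : Subobject F | S.Factors f}

lemma isLeast_extremalImage {G F : Sh Q} (f : G ⟶ F) :
    IsLeast {S : Subobject F | S.Factors f} (extremalImage f) := by
  refine ⟨?_, fun S hS => sInf_le hS⟩
  have fac (j : equivShrink (Subobject F) '' {S : Subobject F | S.Factors f}) :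
      ((equivShrink (Subobject F)).symm j).Factors f := by
    obtain ⟨_, S, hS, rfl⟩ := j
    simpa using hS
  let c : Cone (Subobject.wideCospan {S : Subobject F | S.Factors f}) :=
    WidePullbackShape.mkCone f (fun j => Subobject.factorThru _ f (fac j))
      fun j => Subobject.factorThru_arrow _ f (fac j)
  exact (Subobject.mk_factors_iff _ _).2 ⟨limit.lift _ c, limit.lift_π c none⟩

/-- The morphism `F₀ ⊗_F F₁ ⟶ F₀ ⊗ F₁ ⇉ F`, where `F₀ ⊗_F F₁` is the equalizer of the two
composites `F₀ ⊗ F₁ ⟶ Fᵢ ⟶ F`. -/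
noncomputable def subMulHom {F F₀ F₁ : Sh Q} (φ₀ : F₀ ⟶ F) (φ₁ : F₁ ⟶ F) :
    equalizer (tensorFst F₀ F₁ ≫ φ₀) (tensorSnd F₀ F₁ ≫ φ₁) ⟶ F :=
  equalizer.ι (tensorFst F₀ F₁ ≫ φ₀) (tensorSnd F₀ F₁ ≫ φ₁) ≫ tensorFst F₀ F₁ ≫ φ₀

/-- The operation `*` on the subobjects of a sheaf. -/
noncomputable def subMul {F : Sh Q} (A B : Subobject F) : Subobject F :=
  extremalImage (subMulHom A.arrow B.arrow)

/-- The multiplication of `Q` on the interval `[0, a]`. -/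
def iicMul {a : Q} (q r : Set.Iic a) : Set.Iic a :=
  ⟨q.1 * r.1, (IsSemicartesian.mul_le_fst q.1 r.1).trans q.2⟩

/-- The map `k_a : [0, a] → Sub (Q(-, a))` sending `q` to the class of `Q(-, q) ⟶ Q(-, a)`. -/
noncomputable def kMap (a : Q) (q : Set.Iic a) : Subobject (reprSheaf a) :=
  Subobject.mk (reprMap q.2)

/-- The map `Q → Sub 1` sending `q` to the class of the unique morphism `Q(-, q) ⟶ 1`. -/
noncomputable def kOne (q : Q) : Subobject (⊤_ (Sh Q)) :=
  Subobject.mk (terminal.from (reprSheaf q))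

end Tensor

end QuantaleSheaf

open CategoryTheory CategoryTheory.Limits QuantaleSheaf

/-!
Write `support F` for the join of all `v` with `F v` inhabited. It is the least `q` admitting a
morphism `F ⟶ Q(-, q)`, so `support` is left adjoint to the Yoneda embedding of the poset `Q`. Hence
it is preserved by sheafification, and since maps out of a Day convolution are maps out of the
external product, `support (F ⊗ G) = support F * support G`.

A subterminal sheaf has a section exactly over the `v ≤ support F`, the section over `support F`
being glued from all the others. So sheaf morphisms into subterminal sheaves are governed by
supports: for `F` subterminal, `support` embeds `Sub F` into `Q` with image `[0, support F]` and
turns `*` into the multiplication of `Q`. Both `Q(-, a)` and `1` are subterminal.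

A section over `v` of a sheaf is determined by its restriction to `v * v`, which makes the
monomorphism `Q(-, v * v) ⟶ Q(-, v)` epic. A topos is balanced, so there `v * v = v`, and then
`*` is the meet.
-/

section Quantale

variable {P R : Type*} [PartialOrder P] [PartialOrder R] {m : P → P → P} {n : R → R → R}

lemma IsCommSemicartesianQuantale.of_galoisCoinsertion {l : P → R} {u : R → P}
    (gc : GaloisCoinsertion l u) (map_mul : ∀ x y, l (m x y) = n (l x) (l y))
    (hn : IsCommSemicartesianQuantale n) : IsCommSemicartesianQuantale m := by
  have comm (x y : P) : m x y = m y x := gc.l_injective (by rw [map_mul, map_mul, hn.comm])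
  have mul_isLUB (x : P) (S : Set P) (s : P) (hs : IsLUB S s) : IsLUB (m x '' S) (m x s) := by
    have image_isLUB : IsLUB (l '' (m x '' S)) (l (m x s)) := by
      simpa only [Set.image_image, map_mul] using hn.mul_isLUB (l x) _ _ (gc.gc.isLUB_l_image hs)
    exact image_isLUB.of_image gc.l_le_l_iff
  exact
    { exists_isLUB := fun S => (hn.exists_isLUB (l '' S)).imp' u fun _ => gc.isLUB_of_l_image
      exists_isGLB := fun S => (hn.exists_isGLB (l '' S)).imp' u fun _ => gc.isGLB_of_l_image
      assoc := fun x y z => gc.l_injective (by simp only [map_mul, hn.assoc])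
      mul_isLUB := mul_isLUB
      isLUB_mul := fun x S s hs => by simpa only [comm _ x] using mul_isLUB x S s hs
      comm := comm
      le_fst := fun x y => gc.l_le_l_iff.1 ((map_mul x y).trans_le (hn.le_fst _ _))
      le_snd := fun x y => gc.l_le_l_iff.1 ((map_mul x y).trans_le (hn.le_snd _ _)) }

lemma IsQuantaleIso.isCommSemicartesianQuantale {f : P → R} (hf : IsQuantaleIso m n f)
    (hm : IsCommSemicartesianQuantale m) : IsCommSemicartesianQuantale n := by
  let e : P ≃o R := ⟨Equiv.ofBijective f hf.bijective, hf.le_iff_le _ _⟩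
  have map_mul (x y : P) : e (m x y) = n (e x) (e y) := hf.map_mul x y
  exact hm.of_galoisCoinsertion e.symm.toGaloisCoinsertion fun x y =>
    e.injective (by simp only [map_mul, e.apply_symm_apply])

lemma IsQuantaleIso.of_embeddings {T : Type*} [Preorder T] {t : T → T → T} (i : P ↪o T)
    (j : R ↪o T) (map_mul_i : ∀ x y, i (m x y) = t (i x) (i y))
    (map_mul_j : ∀ x y, j (n x y) = t (j x) (j y)) (range_eq : Set.range i = Set.range j)
    {f : P → R} (hf : ∀ x, j (f x) = i x) : IsQuantaleIso m n f where
  bijective := by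
    refine ⟨fun x y h => i.injective (by rw [← hf, ← hf, h]), fun r => ?_⟩
    obtain ⟨x, hx⟩ : j r ∈ Set.range i := range_eq ▸ Set.mem_range_self r
    exact ⟨x, j.injective ((hf x).trans hx)⟩
  le_iff_le x y := by rw [← j.le_iff_le, hf, hf, i.le_iff_le]
  map_mul x y := j.injective (by rw [hf, map_mul_i, map_mul_j, hf, hf])

end Quantale

namespace QuantaleSheaf

section Quantale

lemma mul_eq_inf_of_isIdempotentElem {Q : Type u} [Mul Q] [SemilatticeInf Q] [MulLeftMono Q]
    [MulRightMono Q] [IsSemicartesian Q] (h : ∀ x : Q, IsIdempotentElem x) (x y : Q) :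
    x * y = x ⊓ y :=
  le_antisymm (le_inf (IsSemicartesian.mul_le_fst x y) (IsSemicartesian.mul_le_snd x y)) <|
    calc
      x ⊓ y = (x ⊓ y) * (x ⊓ y) := (h (x ⊓ y)).eq.symm
      _ ≤ x * y := mul_le_mul' inf_le_left inf_le_right

variable {Q : Type u} [CommSemigroup Q] [CompleteLattice Q] [IsQuantale Q] [IsSemicartesian Q]

variable (Q) in
lemma isCommSemicartesianQuantale_mul : IsCommSemicartesianQuantale fun q r : Q => q * r where
  exists_isLUB S := ⟨sSup S, isLUB_sSup S⟩
  exists_isGLB S := ⟨sInf S, isGLB_sInf S⟩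
  assoc := mul_assoc
  mul_isLUB x _ _ hs :=
    have gc : GaloisConnection (x * ·) (Quantale.rightMulResiduation x) :=
      fun _ _ => Quantale.rightMulResiduation_le_iff_mul_le.symm
    gc.isLUB_l_image hs
  isLUB_mul x _ _ hs :=
    have gc : GaloisConnection (· * x) (Quantale.leftMulResiduation x) :=
      fun _ _ => Quantale.leftMulResiduation_le_iff_mul_le.symm
    gc.isLUB_l_image hs
  comm := mul_comm
  le_fst := IsSemicartesian.mul_le_fst
  le_snd := IsSemicartesian.mul_le_snd

lemma isCommSemicartesianQuantale_iicMul (a : Q) :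
    IsCommSemicartesianQuantale (iicMul (a := a)) := by
  have gc : GaloisConnection (Subtype.val : Set.Iic a → Q) fun q => ⟨q ⊓ a, inf_le_right⟩ :=
    fun x _ => (le_inf_iff.trans (and_iff_left x.2)).symm
  exact (isCommSemicartesianQuantale_mul Q).of_galoisCoinsertion
    (gc.toGaloisCoinsertion fun x => inf_le_left (a := x.1)) fun _ _ => rfl

end Quantale

section Support

variable {Q : Type u} [CompleteLattice Q]

/-- The support of a presheaf: the join of all `v` over which it has a section. It is the
reflection of the presheaf into the poset `Q` of representables. -/
def support (F : Qᵒᵖ ⥤ Type u) : Q := sSup {v | Nonempty (F.obj (op v))}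

variable {F G : Qᵒᵖ ⥤ Type u}

lemma le_support {v : Q} (x : F.obj (op v)) : v ≤ support F := le_sSup ⟨x⟩

lemma support_le_iff {q : Q} : support F ≤ q ↔ ∀ v, Nonempty (F.obj (op v)) → v ≤ q := sSup_le_iff

lemma support_mono (f : F ⟶ G) : support F ≤ support G :=
  support_le_iff.2 fun v ⟨x⟩ => le_support (f.app (op v) x)

lemma support_eq_of_hom (f : F ⟶ G) (g : G ⟶ F) : support F = support G :=
  le_antisymm (support_mono f) (support_mono g)

lemma support_yoneda (a : Q) : support (yoneda.obj a) = a :=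
  le_antisymm (support_le_iff.2 fun _ ⟨f⟩ => leOfHom f) (le_support (F := yoneda.obj a) (𝟙 a))

lemma nonempty_hom_comp_yoneda_iff {C : Type*} [Category C] {P : C ⥤ Type u} {L : C ⥤ Qᵒᵖ}
    {q : Q} : Nonempty (P ⟶ L ⋙ yoneda.obj q) ↔ ∀ c, Nonempty (P.obj c) → (L.obj c).unop ≤ q where
  mp := fun ⟨f⟩ c ⟨x⟩ => leOfHom (f.app c x)
  mpr h :=
    ⟨{ app := fun c => ↾fun x => homOfLE (h c ⟨x⟩)
       naturality := fun _ d _ => by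
        ext x
        exact Subsingleton.elim (α := (yoneda.obj q).obj (L.obj d)) _ _ }⟩

lemma nonempty_hom_yoneda_iff {q : Q} : Nonempty (F ⟶ yoneda.obj q) ↔ support F ≤ q :=
  (nonempty_hom_comp_yoneda_iff (L := 𝟭 _)).trans <|
    ⟨fun h => support_le_iff.2 fun v => h (op v), fun h c => support_le_iff.1 h c.unop⟩

lemma support_leftKanExtension_le_iff {C : Type*} [Category C] (L : C ⥤ Qᵒᵖ) (P : C ⥤ Type u)
    [L.HasLeftKanExtension P] {q : Q} :
    support (L.leftKanExtension P) ≤ q ↔ ∀ c, Nonempty (P.obj c) → (L.obj c).unop ≤ q := by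
  rw [← nonempty_hom_yoneda_iff, ← nonempty_hom_comp_yoneda_iff]
  exact (Functor.homEquivOfIsLeftKanExtension _ (L.leftKanExtensionUnit P) _).nonempty_congr

end Support

lemma support_day {Q : Type u} [CommSemigroup Q] [CompleteLattice Q] [IsQuantale Q]
    (F G : Qᵒᵖ ⥤ Type u) : support (day F G) = support F * support G := by
  refine eq_of_forall_ge_iff fun q => ?_
  rw [day, support_leftKanExtension_le_iff]
  constructor
  · intro h
    rw [support, support, IsQuantale.sSup_mul_distrib]
    refine iSup₂_le fun v ⟨x⟩ => ?_
    rw [IsQuantale.mul_sSup_distrib]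
    exact iSup₂_le fun w ⟨y⟩ => h (op v, op w) ⟨(x, y)⟩
  · rintro h _ ⟨x, y⟩
    exact (mul_le_mul' (le_support x) (le_support y)).trans h

section Subterminal

variable {C : Type*} [Category C] {F G : C}

lemma isSubterminal_of_mono (hG : IsSubterminal G) (f : F ⟶ G) [Mono f] : IsSubterminal F :=
  fun _ _ _ => (cancel_mono f).1 (hG _ _)

lemma factors_iff_nonempty_hom (hF : IsSubterminal F) (f : G ⟶ F) (A : Subobject F) :
    A.Factors f ↔ Nonempty (G ⟶ (A : C)) :=
  ⟨fun h => ⟨A.factorThru f h⟩, fun ⟨g⟩ => hF (g ≫ A.arrow) f ▸ Subobject.factors_comp_arrow g⟩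

end Subterminal

section SubterminalSheaf

variable {Q : Type u} [CommSemigroup Q] [CompleteLattice Q] [IsSemicartesian Q]

lemma isSubterminal_reprSheaf (a : Q) : IsSubterminal (reprSheaf a) := fun _ f g => by
  ext v x
  exact Subsingleton.elim (α := (yoneda.obj a).obj v) _ _

lemma support_sheafification (P : Qᵒᵖ ⥤ Type u) :
    support ((sheafification Q).obj P).obj = support P := by
  refine eq_of_forall_ge_iff fun q => ?_
  rw [← nonempty_hom_yoneda_iff, ← nonempty_hom_yoneda_iff]
  exact ((IsSheaf Q).fullyFaithfulι.homEquiv.symm.trans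
    ((reflectorAdjunction (IsSheaf Q).ι).homEquiv P (reprSheaf q))).nonempty_congr

lemma subsingleton_obj_of_isSubterminal {F : Sh Q} (hF : IsSubterminal F) (v : Q) :
    Subsingleton (F.obj.obj (op v)) where
  allEq x y := by
    obtain ⟨f, rfl⟩ := exists_repr_hom F v x
    obtain ⟨g, rfl⟩ := exists_repr_hom F v y
    rw [hF f g]

lemma nonempty_obj_support_of_isSubterminal {F : Sh Q} (hF : IsSubterminal F) :
    Nonempty (F.obj.obj (op (support F.obj))) := by
  let T : Set Q := {v | Nonempty (F.obj.obj (op v))}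
  obtain ⟨t, -, -⟩ := F.property T (fun v => v) (fun v => v.2.some)
    fun _ _ => (subsingleton_obj_of_isSubterminal hF _).elim _ _
  exact ⟨res F.obj (sSup_eq_iSup' T).le t⟩

lemma nonempty_reprSheaf_hom_iff {F : Sh Q} (hF : IsSubterminal F) {q : Q} :
    Nonempty (reprSheaf q ⟶ F) ↔ q ≤ support F.obj where
  mp := fun ⟨f⟩ => (support_yoneda q).symm.trans_le (support_mono f.hom)
  mpr h :=
    have ⟨t⟩ := nonempty_obj_support_of_isSubterminal hF
    have ⟨f, _⟩ := exists_repr_hom F q (res F.obj h t)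
    ⟨f⟩

lemma nonempty_hom_iff_support_le {F G : Sh Q} (hG : IsSubterminal G) :
    Nonempty (F ⟶ G) ↔ support F.obj ≤ support G.obj where
  mp := fun ⟨f⟩ => support_mono f.hom
  mpr h :=
    have ⟨f⟩ := nonempty_hom_yoneda_iff.2 h
    have ⟨g⟩ := (nonempty_reprSheaf_hom_iff hG).2 le_rfl
    ⟨(ObjectProperty.homMk f : F ⟶ reprSheaf (support G.obj)) ≫ g⟩

variable (Q) in
lemma support_terminal : support (⊤_ (Sh Q)).obj = ⊤ :=
  top_le_iff.1 ((nonempty_reprSheaf_hom_iff isSubterminal_of_terminal).1 ⟨terminal.from _⟩)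

lemma support_mk_reprSheaf {F : Sh Q} {q : Q} (f : reprSheaf q ⟶ F) :
    support (Subobject.mk f : Sh Q).obj = q :=
  (support_eq_of_hom (Subobject.underlyingIso f).hom.hom (Subobject.underlyingIso f).inv.hom).trans
    (support_yoneda q)

variable {F : Sh Q}

lemma factors_iff_support_le (hF : IsSubterminal F) {G : Sh Q} (f : G ⟶ F) (A : Subobject F) :
    A.Factors f ↔ support G.obj ≤ support (A : Sh Q).obj :=
  (factors_iff_nonempty_hom hF f A).trans
    (nonempty_hom_iff_support_le (isSubterminal_of_mono hF A.arrow))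

lemma subobject_le_iff_support_le (hF : IsSubterminal F) {A B : Subobject F} :
    A ≤ B ↔ support (A : Sh Q).obj ≤ support (B : Sh Q).obj := by
  rw [← factors_iff_support_le hF A.arrow]
  exact ⟨fun h => Subobject.factors_of_le _ h A.factors_self, Subobject.le_of_factors⟩

/-- The embedding of the subobjects of a subterminal sheaf into `Q` that sends a subobject to its
support. -/
noncomputable def supportEmbedding (hF : IsSubterminal F) : Subobject F ↪o Q :=
  OrderEmbedding.ofMapLEIff (fun A => support (A : Sh Q).obj) fun _ _ =>
    (subobject_le_iff_support_le hF).symm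

lemma supportEmbedding_mk (hF : IsSubterminal F) {q : Q} (f : reprSheaf q ⟶ F) :
    supportEmbedding hF (Subobject.mk f) = q :=
  support_mk_reprSheaf f

lemma range_supportEmbedding (hF : IsSubterminal F) :
    Set.range (supportEmbedding hF) = Set.Iic (support F.obj) := by
  ext q
  constructor
  · rintro ⟨A, rfl⟩
    exact support_mono A.arrow.hom
  · intro hq
    obtain ⟨f⟩ := (nonempty_reprSheaf_hom_iff hF).2 hq
    exact ⟨Subobject.mk f, supportEmbedding_mk hF f⟩

end SubterminalSheaf

section Tensor

variable {Q : Type u} [CommSemigroup Q] [CompleteLattice Q] [IsQuantale Q] [IsSemicartesian Q]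

lemma support_tensor (F G : Sh Q) :
    support (tensor F G).obj = support F.obj * support G.obj :=
  (support_sheafification _).trans (support_day F.obj G.obj)

variable {F : Sh Q}

lemma support_extremalImage (hF : IsSubterminal F) {G : Sh Q} (f : G ⟶ F) :
    support (extremalImage f : Sh Q).obj = support G.obj := by
  obtain ⟨k⟩ := (nonempty_reprSheaf_hom_iff hF).2 (support_mono f.hom)
  have least_mk : IsLeast {S : Subobject F | S.Factors f} (Subobject.mk k) :=
    ⟨(factors_iff_support_le hF f _).2 (support_mk_reprSheaf k).ge, fun S hS =>
      (subobject_le_iff_support_le hF).2 <|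
        (support_mk_reprSheaf k).trans_le ((factors_iff_support_le hF f S).1 hS)⟩
  rw [(isLeast_extremalImage f).unique least_mk, support_mk_reprSheaf]

lemma support_subMul (hF : IsSubterminal F) (A B : Subobject F) :
    support (subMul A B : Sh Q).obj = support (A : Sh Q).obj * support (B : Sh Q).obj := by
  have h : tensorFst (A : Sh Q) B ≫ A.arrow = tensorSnd (A : Sh Q) B ≫ B.arrow := hF _ _
  have := equalizer.ι_of_eq h
  let e := asIso (equalizer.ι (tensorFst _ _ ≫ A.arrow) (tensorSnd _ _ ≫ B.arrow))
  rw [subMul, support_extremalImage hF, ← support_tensor]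
  exact support_eq_of_hom e.hom.hom e.inv.hom

lemma isQuantaleIso_kMap (a : Q) :
    IsQuantaleIso (iicMul (a := a)) (subMul (F := reprSheaf a)) (kMap a) :=
  have hF := isSubterminal_reprSheaf a
  .of_embeddings (OrderEmbedding.subtype (· ∈ Set.Iic a)) (supportEmbedding hF) (fun _ _ => rfl)
    (support_subMul hF) (by rw [range_supportEmbedding, support_yoneda]; exact Subtype.range_val)
    fun q => supportEmbedding_mk hF (reprMap q.2)

lemma isQuantaleIso_kOne :
    IsQuantaleIso (fun q r : Q => q * r) (subMul (F := ⊤_ (Sh Q))) kOne :=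
  have hF : IsSubterminal (⊤_ (Sh Q)) := isSubterminal_of_terminal
  .of_embeddings (t := fun q r => q * r) (RelEmbedding.refl _) (supportEmbedding hF)
    (fun _ _ => rfl) (support_subMul hF) (by simp [range_supportEmbedding hF, support_terminal])
    fun q => supportEmbedding_mk hF (terminal.from (reprSheaf q))

end Tensor

section Topos

lemma balanced_of_isElementaryTopos {C : Type*} [Category C] (h : IsElementaryTopos C) :
    Balanced C :=
  have ⟨_, _, _, _⟩ := h
  balanced_of_strongMonoCategory

variable {Q : Type u} [CommSemigroup Q] [CompleteLattice Q] [IsSemicartesian Q]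

lemma res_mul_self_injective (F : Sh Q) (v : Q) :
    Function.Injective (res F.obj (IsSemicartesian.mul_le_fst v v)) := by
  intro x y h
  -- `x` and `y` form a compatible family on the cover of `v` that lists `v` twice.
  obtain ⟨t, ht, -⟩ := F.property (ULift Bool) (fun _ => v) (fun i => cond i.down x y) (by
    rintro ⟨_ | _⟩ ⟨_ | _⟩
    exacts [rfl, h.symm, h, rfl])
  exact (ht ⟨true⟩).symm.trans (ht ⟨false⟩)

lemma epi_reprMap_mul_self (v : Q) : Epi (reprMap (IsSemicartesian.mul_le_fst v v)) where
  left_cancellation {F} g h w := by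
    have res_yonedaEquiv (f : reprSheaf v ⟶ F) :
        res F.obj (IsSemicartesian.mul_le_fst v v) (yonedaEquiv f.hom) =
          yonedaEquiv (reprMap (IsSemicartesian.mul_le_fst v v) ≫ f).hom :=
      yonedaEquiv_naturality f.hom _
    ext1
    apply yonedaEquiv.injective
    apply res_mul_self_injective F v
    rw [res_yonedaEquiv, res_yonedaEquiv, w]

lemma isIdempotentElem_of_balanced [Balanced (Sh Q)] (v : Q) : IsIdempotentElem v := by
  have := epi_reprMap_mul_self v
  have := isIso_of_mono_of_epi (reprMap (IsSemicartesian.mul_le_fst v v))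
  let back : reprSheaf v ⟶ reprSheaf (v * v) := inv (reprMap (IsSemicartesian.mul_le_fst v v))
  exact le_antisymm (IsSemicartesian.mul_le_fst v v) (leOfHom (yonedaEquiv back.hom))

lemma mul_eq_inf_of_isElementaryTopos [IsQuantale Q] (h : IsElementaryTopos (Sh Q)) (x y : Q) :
    x * y = x ⊓ y :=
  have := balanced_of_isElementaryTopos h
  mul_eq_inf_of_isIdempotentElem isIdempotentElem_of_balanced x y

end Topos

end QuantaleSheaf

theorem mainTheorem2 {Q : Type u} [CommSemigroup Q] [CompleteLattice Q] [IsQuantale Q]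
    [IsSemicartesian Q] :
    (∀ a : Q,
      IsCommSemicartesianQuantale (subMul (F := reprSheaf a)) ∧
      IsCommSemicartesianQuantale (iicMul (a := a)) ∧
      IsQuantaleIso (iicMul (a := a)) (subMul (F := reprSheaf a)) (kMap a)) ∧
    IsCommSemicartesianQuantale (subMul (F := ⊤_ (Sh Q))) ∧
    IsQuantaleIso (fun q r : Q => q * r) (subMul (F := ⊤_ (Sh Q))) kOne ∧
    ((¬ ∀ x y : Q, x * y = x ⊓ y) → ¬ IsElementaryTopos (Sh Q)) ∧
    ((¬ ∀ (x : Q) (S : Set Q), x ⊓ sSup S = ⨆ y ∈ S, x ⊓ y) → ¬ IsElementaryTopos (Sh Q)) := by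
  refine ⟨fun a => ⟨?_, isCommSemicartesianQuantale_iicMul a, isQuantaleIso_kMap a⟩, ?_,
    isQuantaleIso_kOne, fun h hT => h (mul_eq_inf_of_isElementaryTopos hT), fun h hT => h ?_⟩
  · exact (isQuantaleIso_kMap a).isCommSemicartesianQuantale (isCommSemicartesianQuantale_iicMul a)
  · exact isQuantaleIso_kOne.isCommSemicartesianQuantale (isCommSemicartesianQuantale_mul Q)
  · simpa only [mul_eq_inf_of_isElementaryTopos hT] using IsQuantale.mul_sSup_distrib (α := Q)
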